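/- An MV-algebra is a structure $(A,\oplus,{}^*,0)$ such that $(A,\oplus,0)$ is an abelian monoid and, for all $x,y\in A$, $(x^*)^*=x$, $0^*\oplus x=0^*$ and $(x^*\oplus y)^*\oplus y=(y^*\oplus x)^*\oplus x$; one writes $x\odot y=(x^*\oplus y^*)^*$. The standard MV-algebra is $[0,1]$ with $x\oplus y=\min(x+y,1)$ and $x^*=1-x$. A Riesz MV-algebra is an MV-algebra $R$ with an operation $\cdot:[0,1]\times R\to R$ such that, for all $r,q\in[0,1]$ and $x,y\in R$: $r\cdot(x\odot y^*)=(r\cdot x)\odot(r\cdot y)^*$, $(r\odot q^*)\cdot x=(r\cdot x)\odot(q\cdot x)^*$ (with $r\odot q^*$ computed in the standard MV-algebra), $r\cdot(q\cdot x)=(rq)\cdot x$ and $1\cdot x=x$. Morphisms of Riesz MV-algebras are the maps preserving all these operations. Let $n\ge 0$ be an integer and let $PL_n$ be the set of all continuous functions $f:[0,1]^n\to[0,1]$ that are piecewise linear, i.e. for which there are finitely many affine functions $q_1,\dots,q_k:\mathbb R^n\to\mathbb R$ such that for each $x\in[0,1]^n$ there is $i$ with $f(x)=q_i(x)$. With the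 pointwise operations ($(f\oplus g)(x)=\min(f(x)+g(x),1)$, $f^*(x)=1-f(x)$, $(r\cdot f)(x)=r f(x)$, and the zero function), $PL_n$ is a Riesz MV-algebra. Corollary 7.7. $PL_n$ is the free Riesz MV-algebra with $n$ free generators, the free generators being the coordinate projections $\pi_1,\dots,\pi_n$. That is, the $\pi_i$ are pairwise distinct, they generate $PL_n$ as a Riesz MV-algebra, and for each Riesz MV-algebra $R$ and all $a_1,\dots,a_n\in R$ there is exactly one morphism of Riesz MV-algebras $\varphi:PL_n\to R$ with $\varphi(\pi_i)=a_i$ for $i=1,\dots,n$. -/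

import Mathlib

universe u v w

/-- An MV-algebra `(A, ⊕, *, 0)`. The abelian monoid operation `⊕` is written additively,
and `x*` is written `MVAlgebra.neg x`. -/
class MVAlgebra (A : Type u) extends AddCommMonoid A where
  /-- the unary operation `x ↦ x*` -/
  neg : A → A
  neg_neg : ∀ x : A, neg (neg x) = x
  neg_zero_add : ∀ x : A, neg 0 + x = neg 0
  neg_add_comm : ∀ x y : A, neg (neg x + y) + y = neg (neg y + x) + x

/-- `x ⊙ y = (x* ⊕ y*)*`. -/
def MVAlgebra.odot {A : Type u} [MVAlgebra A] (x y : A) : A :=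
  MVAlgebra.neg (MVAlgebra.neg x + MVAlgebra.neg y)

/-- Truncated addition on `[0,1]`. -/
noncomputable instance unitInterval.instTruncatedAdd : Add unitInterval where
  add x y := ⟨min ((x : ℝ) + y) 1, le_min (add_nonneg x.2.1 y.2.1) zero_le_one, min_le_right _ _⟩

/-- The standard MV-algebra `[0,1]`: `x ⊕ y = min (x + y) 1` and `x* = 1 - x`. -/
noncomputable instance unitInterval.instMVAlgebra : MVAlgebra unitInterval where
  nsmul := nsmulRec
  neg x := unitInterval.symm x
  add_assoc := by
    rintro ⟨x, hx⟩ ⟨y, hy⟩ ⟨z, hz⟩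
    apply Subtype.ext
    change min (min (x + y) 1 + z) 1 = min (x + min (y + z) 1) 1
    have := hx.1
    have := hz.1
    rcases le_total (x + y) 1 with h | h <;> rcases le_total (y + z) 1 with h' | h' <;>
      simp only [min_eq_left, min_eq_right, h, h', add_assoc]
    · rw [min_eq_right (by linarith), min_eq_right (by linarith)]
    · rw [min_eq_right (by linarith), min_eq_right (by linarith)]
    · rw [min_eq_right (by linarith), min_eq_right (by linarith)]
  zero_add := by
    rintro ⟨x, hx⟩
    apply Subtype.ext
    change min (0 + x) 1 = x
    rw [zero_add, min_eq_left hx.2]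
  add_zero := by
    rintro ⟨x, hx⟩
    apply Subtype.ext
    change min (x + 0) 1 = x
    rw [add_zero, min_eq_left hx.2]
  add_comm := by
    rintro ⟨x, hx⟩ ⟨y, hy⟩
    apply Subtype.ext
    change min (x + y) 1 = min (y + x) 1
    rw [add_comm]
  neg_neg x := unitInterval.symm_symm x
  neg_zero_add := by
    rintro ⟨x, hx⟩
    apply Subtype.ext
    change min ((1 - 0) + x) 1 = 1 - 0
    rw [min_eq_right (by linarith [hx.1]), sub_zero]
  neg_add_comm := by
    rintro ⟨x, hx⟩ ⟨y, hy⟩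
    apply Subtype.ext
    change min (1 - min (1 - x + y) 1 + y) 1 = min (1 - min (1 - y + x) 1 + x) 1
    obtain ⟨hx0, hx1⟩ := hx
    obtain ⟨hy0, hy1⟩ := hy
    rcases le_total x y with h | h
    · rw [min_eq_right (by linarith : (1 : ℝ) ≤ 1 - x + y),
        min_eq_left (by linarith : 1 - y + x ≤ 1), min_eq_left (by linarith),
        min_eq_left (by linarith)]
      ring
    · rw [min_eq_left (by linarith : 1 - x + y ≤ 1),
        min_eq_right (by linarith : (1 : ℝ) ≤ 1 - y + x), min_eq_left (by linarith),
        min_eq_left (by linarith)]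
      ring

theorem unitInterval.coe_mv_add (x y : unitInterval) :
    ((x + y : unitInterval) : ℝ) = min ((x : ℝ) + y) 1 := rfl

theorem unitInterval.coe_mv_neg (x : unitInterval) :
    ((MVAlgebra.neg x : unitInterval) : ℝ) = 1 - x := rfl

theorem unitInterval.coe_odot_neg (x y : unitInterval) :
    ((MVAlgebra.odot x (MVAlgebra.neg y) : unitInterval) : ℝ) = max ((x : ℝ) - y) 0 := by
  change 1 - min ((1 - (x : ℝ)) + (1 - (1 - (y : ℝ)))) 1 = max ((x : ℝ) - y) 0
  rcases le_total (x : ℝ) y with h | h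
  · rw [min_eq_right (by linarith), max_eq_right (by linarith)]; ring
  · rw [min_eq_left (by linarith), max_eq_left (by linarith)]; ring

/-- A Riesz MV-algebra: an MV-algebra with a scalar multiplication by elements of `[0,1]`.
In `odot_neg_smul` the operations applied to `r` and `q` are those of the standard MV-algebra
`[0,1]`, and in `smul_smul` the product `r * q` is the product of real numbers. -/
class RieszMVAlgebra (R : Type u) extends MVAlgebra R, SMul unitInterval R where
  smul_odot_neg : ∀ (r : unitInterval) (x y : R),
    r • MVAlgebra.odot x (MVAlgebra.neg y) = MVAlgebra.odot (r • x) (MVAlgebra.neg (r • y))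
  odot_neg_smul : ∀ (r q : unitInterval) (x : R),
    MVAlgebra.odot r (MVAlgebra.neg q) • x = MVAlgebra.odot (r • x) (MVAlgebra.neg (q • x))
  smul_smul : ∀ (r q : unitInterval) (x : R), r • (q • x) = (r * q) • x
  one_smul : ∀ x : R, (1 : unitInterval) • x = x

/-- The standard Riesz MV-algebra `[0,1]`, with scalar multiplication the real product. -/
noncomputable instance unitInterval.instRieszMVAlgebra : RieszMVAlgebra unitInterval where
  smul r x := r * x
  smul_odot_neg r x y := by
    apply Subtype.ext
    rw [unitInterval.coe_odot_neg]
    change (r : ℝ) * (MVAlgebra.odot x (MVAlgebra.neg y) : unitInterval) =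
      max ((r : ℝ) * x - r * y) 0
    rw [unitInterval.coe_odot_neg, mul_max_of_nonneg _ _ r.2.1, mul_sub, mul_zero]
  odot_neg_smul r q x := by
    apply Subtype.ext
    rw [unitInterval.coe_odot_neg]
    change ((MVAlgebra.odot r (MVAlgebra.neg q) : unitInterval) : ℝ) * x =
      max ((r : ℝ) * x - q * x) 0
    rw [unitInterval.coe_odot_neg, max_mul_of_nonneg _ _ x.2.1, sub_mul, zero_mul]
  smul_smul r q x := (mul_assoc r q x).symm
  one_smul x := one_mul x

/-- Morphisms of Riesz MV-algebras: maps preserving all the operations. -/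
structure RieszMVHom (R : Type u) (S : Type v) [RieszMVAlgebra R] [RieszMVAlgebra S] where
  /-- the underlying map -/
  toFun : R → S
  map_zero : toFun 0 = 0
  map_add : ∀ x y : R, toFun (x + y) = toFun x + toFun y
  map_neg : ∀ x : R, toFun (MVAlgebra.neg x) = MVAlgebra.neg (toFun x)
  map_smul : ∀ (r : unitInterval) (x : R), toFun (r • x) = r • toFun x

/-- A set closed under all the operations of a Riesz MV-algebra. -/
structure RieszMVAlgebra.IsSubalgebra {R : Type u} [RieszMVAlgebra R] (S : Set R) : Prop where
  zero_mem : (0 : R) ∈ S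
  add_mem : ∀ x ∈ S, ∀ y ∈ S, x + y ∈ S
  neg_mem : ∀ x ∈ S, MVAlgebra.neg x ∈ S
  smul_mem : ∀ (r : unitInterval), ∀ x ∈ S, r • x ∈ S

/-- `F` is the free Riesz MV-algebra with free generators `g i`: the `g i` are distinct, they
generate `F`, and each assignment of the generators to elements of a Riesz MV-algebra `R`
extends to exactly one morphism `F → R`. -/
structure RieszMVAlgebra.IsFreelyGeneratedBy {ι : Type w} {F : Type u} [RieszMVAlgebra F]
    (g : ι → F) : Prop where
  injective : Function.Injective g
  generates : ∀ S : Set F, RieszMVAlgebra.IsSubalgebra S → (∀ i, g i ∈ S) → S = Set.univ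
  existsUnique_hom : ∀ (R : Type v) [RieszMVAlgebra R] (a : ι → R),
    ∃! φ : RieszMVHom F R, ∀ i, φ.toFun (g i) = a i

/-- `f : [0,1]^n → [0,1]` is piecewise linear: there is a finite set of affine functions
`ℝ^n → ℝ` such that at each point of the cube, `f` agrees with one of them. -/
def IsPiecewiseLinear {n : ℕ} (f : (Fin n → unitInterval) → unitInterval) : Prop :=
  ∃ Q : Set ((Fin n → ℝ) →ᵃ[ℝ] ℝ), Q.Finite ∧
    ∀ x : Fin n → unitInterval, ∃ q ∈ Q, (f x : ℝ) = q (fun i => (x i : ℝ))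

/-- `PL n`: the continuous piecewise linear functions `[0,1]^n → [0,1]`. -/
def PL (n : ℕ) : Type :=
  {f : (Fin n → unitInterval) → unitInterval // Continuous f ∧ IsPiecewiseLinear f}

namespace PL

variable {n : ℕ}

/-- The coordinate projection `x ↦ x i`. -/
def proj (i : Fin n) : PL n :=
  ⟨fun x => x i, continuous_apply i,
    {(LinearMap.proj i : (Fin n → ℝ) →ₗ[ℝ] ℝ).toAffineMap}, Set.finite_singleton _,
    fun _ => ⟨_, rfl, rfl⟩⟩

/-- The zero function. -/
def zero : PL n :=
  ⟨fun _ => 0, continuous_const, {0}, Set.finite_singleton _, fun _ => ⟨_, rfl, rfl⟩⟩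

/-- Pointwise `⊕`. -/
noncomputable def add (f g : PL n) : PL n :=
  ⟨fun x => f.1 x + g.1 x, by
    refine ⟨Continuous.subtype_mk (((continuous_subtype_val.comp f.2.1).add
      (continuous_subtype_val.comp g.2.1)).min continuous_const) _, ?_⟩
    obtain ⟨P, hP, hf⟩ := f.2.2
    obtain ⟨Q, hQ, hg⟩ := g.2.2
    refine ⟨insert (AffineMap.const ℝ _ 1) (Set.image2 (fun p q => p + q) P Q),
      (hP.image2 _ hQ).insert _, fun x => ?_⟩
    obtain ⟨p, hp, hfp⟩ := hf x
    obtain ⟨q, hq, hgq⟩ := hg x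
    rw [unitInterval.coe_mv_add]
    rcases le_total ((f.1 x : ℝ) + g.1 x) 1 with h | h
    · refine ⟨p + q, Or.inr ⟨p, hp, q, hq, rfl⟩, ?_⟩
      rw [min_eq_left h, hfp, hgq]
      rfl
    · exact ⟨_, Or.inl rfl, by rw [min_eq_right h]; rfl⟩⟩

/-- Pointwise `*`. -/
noncomputable def neg (f : PL n) : PL n :=
  ⟨fun x => MVAlgebra.neg (f.1 x), by
    refine ⟨unitInterval.continuous_symm.comp f.2.1, ?_⟩
    obtain ⟨P, hP, hf⟩ := f.2.2
    refine ⟨(fun p => AffineMap.const ℝ _ 1 - p) '' P, hP.image _, fun x => ?_⟩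
    obtain ⟨p, hp, hfp⟩ := hf x
    refine ⟨_, ⟨p, hp, rfl⟩, ?_⟩
    rw [unitInterval.coe_mv_neg, hfp]
    rfl⟩

/-- Pointwise scalar multiplication. -/
noncomputable def smul (r : unitInterval) (f : PL n) : PL n :=
  ⟨fun x => r • f.1 x, by
    refine ⟨Continuous.subtype_mk (continuous_const.mul (continuous_subtype_val.comp f.2.1)) _, ?_⟩
    obtain ⟨P, hP, hf⟩ := f.2.2
    refine ⟨(fun p => (r : ℝ) • p) '' P, hP.image _, fun x => ?_⟩
    obtain ⟨p, hp, hfp⟩ := hf x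
    refine ⟨_, ⟨p, hp, rfl⟩, ?_⟩
    change (r : ℝ) * f.1 x = (r : ℝ) * p _
    rw [hfp]⟩

noncomputable instance instAdd : Add (PL n) := ⟨add⟩

instance instZero : Zero (PL n) := ⟨zero⟩

/-- `PL n` is a Riesz MV-algebra with the pointwise operations. -/
noncomputable instance instRieszMVAlgebra : RieszMVAlgebra (PL n) where
  nsmul := nsmulRec
  neg := neg
  smul := smul
  add_assoc f g h := Subtype.ext (funext fun x => add_assoc (f.1 x) (g.1 x) (h.1 x))
  zero_add f := Subtype.ext (funext fun x => zero_add (f.1 x))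
  add_zero f := Subtype.ext (funext fun x => add_zero (f.1 x))
  add_comm f g := Subtype.ext (funext fun x => add_comm (f.1 x) (g.1 x))
  neg_neg f := Subtype.ext (funext fun x => MVAlgebra.neg_neg (f.1 x))
  neg_zero_add f := Subtype.ext (funext fun x => MVAlgebra.neg_zero_add (f.1 x))
  neg_add_comm f g := Subtype.ext (funext fun x => MVAlgebra.neg_add_comm (f.1 x) (g.1 x))
  smul_odot_neg r f g :=
    Subtype.ext (funext fun x => RieszMVAlgebra.smul_odot_neg r (f.1 x) (g.1 x))
  odot_neg_smul r q f :=
    Subtype.ext (funext fun x => RieszMVAlgebra.odot_neg_smul r q (f.1 x))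
  smul_smul r q f := Subtype.ext (funext fun x => RieszMVAlgebra.smul_smul r q (f.1 x))
  one_smul f := Subtype.ext (funext fun x => RieszMVAlgebra.one_smul (f.1 x))

end PL

/-! Two facts carry the theorem. The projections generate `PL n` (`PL.eq_univ_of_proj_mem`), so
every element is the value of a term at the projections. And an equation between terms that holds in
`[0,1]` holds in every Riesz MV-algebra (`RieszTerm.eval_eq_eval`), so sending the value of a term
at the projections to its value at `a` is well defined. Uniqueness follows from generation.

Generation: a continuous piecewise linear function is a maximum of minima of its affine components,
clipped to `[0,1]`; lattice operations and clipped affine functions are expressible by the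
operations. The maximum-minimum form rests on `exists_affine_ge_le`, a statement about one real
variable.

Completeness: if a term has nonzero value in `R`, this survives in a totally ordered quotient
(`exists_hom_chain_ne_zero`). Only finitely many elements of that chain matter for the evaluation.
Hahn-Banach gives a real functional on them that respects the untruncated linear relations and is
positive at nonzero elements (`exists_pos_additive_on`). Normalized at the top element, it carries
the evaluation to one in `[0,1]` with nonzero value. -/

namespace MVAlgebra

/-! ### Order and lattice structure of MV-algebras -/

section Order

variable {A : Type u} [MVAlgebra A]

/-- Truncated subtraction `x ⊖ y = x ⊙ y*`. -/
def tsub (x y : A) : A := neg (neg x + y)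

local infixl:65 " ⊖ " => tsub

theorem odot_neg (x y : A) : odot x (neg y) = x ⊖ y := by
  simp only [odot, tsub, neg_neg]

theorem neg_injective : Function.Injective (neg : A → A) := fun x y h => by
  rw [← neg_neg x, h, neg_neg]

theorem add_neg_zero (x : A) : x + neg 0 = neg 0 := by
  rw [add_comm, neg_zero_add]

theorem neg_add_self (x : A) : neg x + x = neg 0 := by
  have h := neg_add_comm x (neg 0)
  rwa [add_neg_zero, neg_neg, zero_add, eq_comm] at h

theorem tsub_add_comm (x y : A) : x ⊖ y + y = y ⊖ x + x := neg_add_comm x y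

theorem tsub_eq_zero_iff {x y : A} : x ⊖ y = 0 ↔ neg x + y = neg 0 := by
  rw [tsub]
  exact ⟨fun h => by rw [← h, neg_neg], fun h => by rw [h, neg_neg]⟩

theorem tsub_self (x : A) : x ⊖ x = 0 := tsub_eq_zero_iff.2 (neg_add_self x)

/-- The lattice order of an MV-algebra as a partial order: `x ≤ y` if and only if `x ⊖ y = 0`. -/
@[reducible] def partialOrder : PartialOrder A where
  le x y := x ⊖ y = 0
  le_refl := tsub_self
  le_antisymm x y hxy hyx := by
    have h := tsub_add_comm x y
    rwa [hxy, hyx, zero_add, zero_add, eq_comm] at h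
  le_trans x y z hxy hyz := by
    have h := tsub_add_comm z y
    rw [hyz, zero_add] at h
    rw [tsub_eq_zero_iff] at hxy ⊢
    rw [← h, add_left_comm, hxy, add_neg_zero]

attribute [local instance] partialOrder

theorem le_iff_tsub {x y : A} : x ≤ y ↔ x ⊖ y = 0 := Iff.rfl

theorem le_iff_add {x y : A} : x ≤ y ↔ neg x + y = neg 0 := tsub_eq_zero_iff

theorem tsub_le_iff {x y z : A} : x ⊖ y ≤ z ↔ x ≤ y + z := by
  rw [le_iff_add, le_iff_add, tsub, neg_neg, add_assoc]

theorem neg_le_neg_iff {x y : A} : neg x ≤ neg y ↔ y ≤ x := by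
  rw [le_iff_add, le_iff_add, neg_neg, add_comm]

theorem le_neg_comm {x y : A} : x ≤ neg y ↔ y ≤ neg x := by
  rw [← neg_le_neg_iff, neg_neg]

theorem zero_le (x : A) : 0 ≤ x := by
  rw [le_iff_add, neg_zero_add]

theorem le_neg_zero (x : A) : x ≤ neg 0 := by
  rw [le_neg_comm]; exact zero_le _

theorem le_zero_iff {x : A} : x ≤ 0 ↔ x = 0 :=
  ⟨fun h => le_antisymm h (zero_le x), fun h => h.le⟩

theorem le_add_right (x y : A) : x ≤ x + y := by
  rw [le_iff_add, ← add_assoc, neg_add_self, neg_zero_add]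

theorem le_add_left (x y : A) : x ≤ y + x := by
  rw [add_comm]; exact le_add_right x y

theorem tsub_add_cancel {x y : A} (h : y ≤ x) : x ⊖ y + y = x := by
  rw [tsub_add_comm, le_iff_tsub.1 h, zero_add]

theorem add_le_add_right' {x y : A} (h : x ≤ y) (z : A) : x + z ≤ y + z := by
  rw [← tsub_add_cancel h, add_assoc]
  exact le_add_left _ _

theorem add_le_add' {x y z w : A} (h : x ≤ y) (h' : z ≤ w) : x + z ≤ y + w :=
  (add_le_add_right' h z).trans (by rw [add_comm y, add_comm y]; exact add_le_add_right' h' y)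

theorem tsub_le_tsub {x y z w : A} (h : x ≤ y) (h' : w ≤ z) : x ⊖ z ≤ y ⊖ w := by
  rw [tsub, tsub, neg_le_neg_iff]
  exact add_le_add' (neg_le_neg_iff.2 h) h'

theorem tsub_le_self (x y : A) : x ⊖ y ≤ x := by
  rw [tsub_le_iff]; exact le_add_left _ _

theorem tsub_le_neg (x y : A) : x ⊖ y ≤ neg y := by
  rw [tsub, neg_le_neg_iff]; exact le_add_left _ _

theorem neg_tsub_neg (x y : A) : neg x ⊖ neg y = y ⊖ x := by
  rw [tsub, tsub, neg_neg, add_comm]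

/-- The lattice structure of an MV-algebra. -/
@[reducible] def lattice : Lattice A where
  __ := partialOrder
  sup x y := x ⊖ y + y
  le_sup_left x y := by rw [tsub_add_comm]; exact le_add_left _ _
  le_sup_right x y := le_add_left _ _
  sup_le x y z hx hy := by
    rw [← tsub_add_cancel hy]
    exact add_le_add_right' (tsub_le_tsub hx le_rfl) y
  inf x y := neg (neg x ⊖ neg y + neg y)
  inf_le_left x y := by
    rw [← neg_le_neg_iff, neg_neg, tsub_add_comm]; exact le_add_left _ _
  inf_le_right x y := by
    rw [← neg_le_neg_iff, neg_neg]; exact le_add_left _ _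
  le_inf x y z hx hy := by
    rw [← neg_le_neg_iff, neg_neg, ← tsub_add_cancel (neg_le_neg_iff.2 hy)]
    exact add_le_add_right' (tsub_le_tsub (neg_le_neg_iff.2 hx) le_rfl) _

attribute [local instance] lattice

/-- The condition `x ≤ neg y` expresses that the sum is not truncated; throughout, it is what
permits cancellation and linear reasoning. -/
theorem add_tsub_cancel {x y : A} (h : x ≤ neg y) : x + y ⊖ y = x := by
  apply neg_injective
  have h' := tsub_add_cancel (le_neg_comm.1 h)
  rw [tsub, neg_neg] at h'
  rw [tsub, neg_neg, h']

theorem add_eq_neg_zero {x y : A} (h : neg y ≤ x) : x + y = neg 0 := by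
  rw [le_iff_add, neg_neg] at h
  rwa [add_comm]

theorem add_inf_le (x y z : A) : (x + z) ⊓ (y + z) ≤ (x ⊓ y) + z := by
  rw [add_comm (x ⊓ y), ← tsub_le_iff]
  refine le_inf ?_ ?_
  · rw [tsub_le_iff, add_comm z]; exact inf_le_left
  · rw [tsub_le_iff, add_comm z]; exact inf_le_right

theorem inf_add_eq_zero {x y z : A} (hy : x ⊓ y = 0) (hz : x ⊓ z = 0) : x ⊓ (y + z) = 0 := by
  rw [← le_zero_iff, ← hz]
  refine le_inf inf_le_left ?_
  calc x ⊓ (y + z) ≤ (x + z) ⊓ (y + z) := inf_le_inf_right _ (le_add_right _ _)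
    _ ≤ (x ⊓ y) + z := add_inf_le _ _ _
    _ = z := by rw [hy, zero_add]

theorem inf_nsmul_eq_zero {x y : A} (h : x ⊓ y = 0) (k : ℕ) : x ⊓ (k • y) = 0 := by
  induction k with
  | zero => rw [zero_nsmul, ← le_zero_iff]; exact (inf_le_right : x ⊓ 0 ≤ 0)
  | succ k ih => rw [succ_nsmul]; exact inf_add_eq_zero ih h

/-- Let `m` be the infimum and `z` the supremum of `x` and `y`. Since `y = z ⊖ (x ⊖ y)` and
symmetrically, removing `m` from `z` leaves an upper bound of both, so `z ⊖ m = z`. Adding `m` back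
is an untruncated sum equal to `z`, and cancelling `z` gives `m = 0`. -/
theorem tsub_inf_tsub (x y : A) : (x ⊖ y) ⊓ (y ⊖ x) = 0 := by
  set m := (x ⊖ y) ⊓ (y ⊖ x) with hm
  set z := x ⊖ y + y with hz
  have hz' : z = y ⊖ x + x := tsub_add_comm x y
  have h1 : y ≤ z ⊖ m := by
    have := add_tsub_cancel (le_neg_comm.1 (tsub_le_neg x y))
    rw [add_comm, ← hz] at this
    conv_lhs => rw [← this]
    exact tsub_le_tsub le_rfl inf_le_left
  have h2 : x ≤ z ⊖ m := by
    have := add_tsub_cancel (le_neg_comm.1 (tsub_le_neg y x))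
    rw [add_comm, ← hz'] at this
    conv_lhs => rw [← this]
    exact tsub_le_tsub le_rfl inf_le_right
  have h3 : z ≤ z ⊖ m := sup_le h2 h1
  have hmz : m ≤ z := inf_le_left.trans (le_add_right _ _)
  have h4 : z ⊖ m = z := le_antisymm (tsub_le_self _ _) h3
  have h5 := tsub_add_cancel hmz
  rw [h4] at h5
  have h6 := add_tsub_cancel (x := m) (y := z ⊖ m) (le_neg_comm.1 (tsub_le_neg z m))
  rwa [h4, add_comm, h5, tsub_self, eq_comm] at h6

theorem tsub_le_tsub_add_tsub (x y z : A) : x ⊖ z ≤ (x ⊖ y) + (y ⊖ z) := by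
  rw [tsub_le_iff, add_left_comm, ← tsub_le_iff, tsub_le_iff, add_comm]
  exact (tsub_le_iff.1 le_rfl).trans (add_le_add_right' (tsub_le_iff.1 le_rfl) _)

theorem add_tsub_add_le (x y z w : A) : x + y ⊖ (z + w) ≤ (x ⊖ z) + (y ⊖ w) := by
  rw [tsub_le_iff, add_add_add_comm]
  refine add_le_add' ?_ ?_ <;> rw [← tsub_le_iff]

end Order

end MVAlgebra

namespace RieszMVAlgebra

/-! ### Scalars and untruncated sums -/

section Scalar

open MVAlgebra

local infixl:65 " ⊖ " => MVAlgebra.tsub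
attribute [local instance] MVAlgebra.partialOrder MVAlgebra.lattice

variable {R : Type u} [RieszMVAlgebra R]

theorem smul_tsub (r : unitInterval) (x y : R) : r • (x ⊖ y) = r • x ⊖ r • y := by
  rw [← odot_neg, ← odot_neg, smul_odot_neg]

theorem tsub_smul (r q : unitInterval) (x : R) : (r ⊖ q) • x = r • x ⊖ q • x := by
  rw [← odot_neg, ← odot_neg, odot_neg_smul]

theorem coe_tsub (r q : unitInterval) : ((r ⊖ q : unitInterval) : ℝ) = max ((r : ℝ) - q) 0 := by
  rw [← odot_neg, unitInterval.coe_odot_neg]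

theorem zero_smul (x : R) : (0 : unitInterval) • x = 0 := by
  rw [← MVAlgebra.tsub_self (0 : unitInterval), tsub_smul, MVAlgebra.tsub_self]

theorem smul_zero (r : unitInterval) : r • (0 : R) = 0 := by
  rw [← MVAlgebra.tsub_self (0 : R), smul_tsub, MVAlgebra.tsub_self, MVAlgebra.tsub_self]

theorem smul_le_smul_left (r : unitInterval) {x y : R} (h : x ≤ y) : r • x ≤ r • y := by
  rw [le_iff_tsub] at h ⊢
  rw [← smul_tsub, h, smul_zero]

theorem smul_le_smul_right {r q : unitInterval} (h : (r : ℝ) ≤ q) (x : R) : r • x ≤ q • x := by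
  have h0 : r ⊖ q = 0 := Subtype.ext (by rw [coe_tsub, max_eq_right (by linarith)]; rfl)
  rw [le_iff_tsub, ← tsub_smul, h0, zero_smul]

theorem smul_le_self (r : unitInterval) (x : R) : r • x ≤ x := by
  conv_rhs => rw [← RieszMVAlgebra.one_smul x]
  exact smul_le_smul_right r.2.2 x

/-- The axioms distribute scalars over differences only; writing `r = s ⊖ q` converts this into
distributivity over an untruncated sum. -/
theorem add_smul_of_coe_eq {r q s : unitInterval} (h : (s : ℝ) = r + q) (x : R) :
    s • x = r • x + q • x := by
  have h0 : s ⊖ q = r := Subtype.ext (by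
    rw [coe_tsub, h, add_sub_cancel_right, max_eq_left r.2.1])
  rw [← h0, tsub_smul, tsub_add_cancel]
  exact smul_le_smul_right (by linarith [r.2.1]) x

theorem smul_add_of_le_neg (r : unitInterval) {x y : R} (h : x ≤ neg y) :
    r • (x + y) = r • x + r • y := by
  conv_rhs => rw [← add_tsub_cancel h, smul_tsub]
  rw [tsub_add_cancel]
  exact smul_le_smul_left r (le_add_left _ _)

/-- The complement of `q • neg 0` is `(1 ⊖ q) • neg 0`, and `r ≤ 1 - q`. -/
theorem smul_neg_zero_le {r q : unitInterval} (h : (r : ℝ) + q ≤ 1) :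
    r • neg (0 : R) ≤ neg (q • neg 0) := by
  have h1 : ∀ z : R, neg z = neg 0 ⊖ z := fun z => by rw [tsub, MVAlgebra.neg_neg, zero_add]
  have h2 : (1 : unitInterval) • neg (0 : R) = neg 0 := RieszMVAlgebra.one_smul _
  rw [h1 (q • neg 0)]
  conv_rhs => rw [← h2]
  rw [RieszMVAlgebra.smul_smul, mul_one, ← tsub_smul]
  refine smul_le_smul_right ?_ _
  rw [coe_tsub]
  refine le_max_of_le_left ?_
  simp only [Set.Icc.coe_one]
  linarith

theorem le_neg_of_le_smul {r q : unitInterval} (h : (r : ℝ) + q ≤ 1) {x y : R}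
    (hx : x ≤ r • neg 0) (hy : y ≤ q • neg 0) : x ≤ neg y :=
  (hx.trans (smul_neg_zero_le h)).trans (neg_le_neg_iff.2 hy)

/-- Some power of `1/2` is below `r`, and an element is the sum of its two halves, so it vanishes if
its half does. -/
theorem smul_eq_zero {r : unitInterval} (hr : 0 < (r : ℝ)) {x : R} (h : r • x = 0) : x = 0 := by
  obtain ⟨k, hk⟩ := exists_pow_lt_of_lt_one hr (by norm_num : (1 / 2 : ℝ) < 1)
  let t : unitInterval := ⟨1 / 2, by norm_num, by norm_num⟩
  have half : ∀ y : R, t • y = 0 → y = 0 := fun y hy => by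
    have := add_smul_of_coe_eq (r := t) (q := t) (s := 1) (by simp [t]; norm_num) y
    rwa [RieszMVAlgebra.one_smul, hy, zero_add] at this
  have main : ∀ (k : ℕ) (y : R), (t ^ k) • y = 0 → y = 0 := fun k => by
    induction k with
    | zero => intro y hy; rwa [pow_zero, RieszMVAlgebra.one_smul] at hy
    | succ k ih =>
      intro y hy
      rw [pow_succ, ← RieszMVAlgebra.smul_smul] at hy
      exact half _ (ih _ hy)
  apply main k
  rw [← MVAlgebra.le_zero_iff, ← h]
  apply smul_le_smul_right
  simpa [t] using hk.le

end Scalar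

end RieszMVAlgebra

namespace MVAlgebra

/-! ### Ideals and primeness -/

section Ideal

local infixl:65 " ⊖ " => MVAlgebra.tsub
attribute [local instance] MVAlgebra.partialOrder MVAlgebra.lattice

variable {A : Type u} [MVAlgebra A]

/-- Ideals of an MV-algebra. -/
structure IsIdeal (P : Set A) : Prop where
  zero_mem : (0 : A) ∈ P
  add_mem : ∀ {x y : A}, x ∈ P → y ∈ P → x + y ∈ P
  mem_of_le : ∀ {x y : A}, x ≤ y → y ∈ P → x ∈ P

theorem isIdeal_singleton_zero : IsIdeal ({0} : Set A) where
  zero_mem := rfl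
  add_mem := by
    rintro x y rfl rfl
    exact zero_add _
  mem_of_le := by
    rintro x y h rfl
    exact MVAlgebra.le_zero_iff.1 h

/-- The ideal generated by an ideal `P` and an element `a`. -/
theorem IsIdeal.adjoin {P : Set A} (hP : IsIdeal P) (a : A) :
    IsIdeal {z : A | ∃ p ∈ P, ∃ k : ℕ, z ≤ p + k • a} where
  zero_mem := ⟨0, hP.zero_mem, 0, zero_le _⟩
  add_mem := by
    rintro x y ⟨p, hp, k, hx⟩ ⟨q, hq, l, hy⟩
    refine ⟨p + q, hP.add_mem hp hq, k + l, ?_⟩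
    rw [add_nsmul, add_add_add_comm]
    exact add_le_add' hx hy
  mem_of_le := by
    rintro x y h ⟨p, hp, k, hy⟩
    exact ⟨p, hp, k, h.trans hy⟩

theorem exists_maximal_ideal_notMem {t : A} (ht : t ≠ 0) :
    ∃ P : Set A, Maximal (fun P => IsIdeal P ∧ t ∉ P) P := by
  obtain ⟨P, -, hP⟩ := zorn_subset_nonempty {P : Set A | IsIdeal P ∧ t ∉ P} (by
    rintro c hc hchain ⟨Q, hQ⟩
    refine ⟨⋃₀ c, ⟨⟨⟨Q, hQ, (hc hQ).1.zero_mem⟩, ?_, ?_⟩, ?_⟩,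
      fun s hs => Set.subset_sUnion_of_mem hs⟩
    · rintro x y ⟨S, hS, hx⟩ ⟨T, hT, hy⟩
      rcases hchain.total hS hT with h | h
      · exact ⟨T, hT, (hc hT).1.add_mem (h hx) hy⟩
      · exact ⟨S, hS, (hc hS).1.add_mem hx (h hy)⟩
    · rintro x y h ⟨S, hS, hy⟩
      exact ⟨S, hS, (hc hS).1.mem_of_le h hy⟩
    · rintro ⟨S, hS, h⟩
      exact (hc hS).2 h) {0} ⟨isIdeal_singleton_zero, ht⟩
  exact ⟨P, hP⟩

/-- If neither difference is in `P`, adjoining either one captures `t`, so `t` is below `p + k • (x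
⊖ y)` and below `q + l • (y ⊖ x)` with `p`, `q` in `P`. The two multiples are disjoint, whence `t ≤
p + q`, contradicting `t ∉ P`. -/
theorem tsub_mem_or_tsub_mem_of_maximal {t : A} {P : Set A}
    (hP : Maximal (fun P => IsIdeal P ∧ t ∉ P) P) (x y : A) : x ⊖ y ∈ P ∨ y ⊖ x ∈ P := by
  have key : ∀ a : A, a ∉ P → ∃ p ∈ P, ∃ k : ℕ, t ≤ p + k • a := by
    intro a ha
    by_contra hcon
    have hsub : P ⊆ {z : A | ∃ p ∈ P, ∃ k : ℕ, z ≤ p + k • a} :=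
      fun p hp => ⟨p, hp, 0, le_add_right _ _⟩
    exact ha (hP.2 ⟨hP.1.1.adjoin a, hcon⟩ hsub
      ⟨0, hP.1.1.zero_mem, 1, by rw [one_nsmul]; exact le_add_left _ _⟩)
  by_contra! hcon
  obtain ⟨p, hp, k, hpk⟩ := key _ hcon.1
  obtain ⟨q, hq, l, hql⟩ := key _ hcon.2
  have h0 : (k • (x ⊖ y)) ⊓ (l • (y ⊖ x)) = 0 := by
    refine inf_nsmul_eq_zero ?_ l
    rw [inf_comm]
    refine inf_nsmul_eq_zero ?_ k
    rw [inf_comm]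
    exact tsub_inf_tsub x y
  refine hP.1.2 (hP.1.1.mem_of_le ?_ (hP.1.1.add_mem hp hq))
  calc t ≤ (k • (x ⊖ y) + (p + q)) ⊓ (l • (y ⊖ x) + (p + q)) := by
        refine le_inf (hpk.trans ?_) (hql.trans ?_)
        · rw [add_comm]; exact add_le_add' le_rfl (le_add_right _ _)
        · rw [add_comm]; exact add_le_add' le_rfl (le_add_left _ _)
    _ ≤ _ := add_inf_le _ _ _
    _ = p + q := by rw [h0, zero_add]

/-- The congruence of an ideal: `x` and `y` are related if both differences are in the ideal. -/
def IsIdeal.setoid {P : Set A} (hP : IsIdeal P) : Setoid A where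
  r x y := x ⊖ y ∈ P ∧ y ⊖ x ∈ P
  iseqv := by
    refine ⟨fun x => ?_, fun h => ⟨h.2, h.1⟩, fun {x y z} h h' => ⟨?_, ?_⟩⟩
    · rw [MVAlgebra.tsub_self]; exact ⟨hP.zero_mem, hP.zero_mem⟩
    · exact hP.mem_of_le (tsub_le_tsub_add_tsub x y z) (hP.add_mem h.1 h'.1)
    · exact hP.mem_of_le (tsub_le_tsub_add_tsub z y x) (hP.add_mem h'.2 h.2)

end Ideal

end MVAlgebra

namespace RieszMVAlgebra

/-! ### Totally ordered quotients -/

section Quotient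

open MVAlgebra

local infixl:65 " ⊖ " => MVAlgebra.tsub
attribute [local instance] MVAlgebra.partialOrder MVAlgebra.lattice

variable {R : Type u} [RieszMVAlgebra R] {P : Set R}

/-- The quotient of a Riesz MV-algebra by an ideal. -/
def QuotientByIdeal (hP : IsIdeal P) : Type u := Quotient hP.setoid

namespace QuotientByIdeal

/-- The quotient map. -/
def mk (hP : IsIdeal P) (x : R) : QuotientByIdeal hP := Quotient.mk _ x

instance (hP : IsIdeal P) : Zero (QuotientByIdeal hP) := ⟨mk hP 0⟩

instance (hP : IsIdeal P) : Add (QuotientByIdeal hP) :=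
  ⟨Quotient.map₂ (· + ·) fun _ _ h _ _ h' =>
    ⟨hP.mem_of_le (add_tsub_add_le _ _ _ _) (hP.add_mem h.1 h'.1),
      hP.mem_of_le (add_tsub_add_le _ _ _ _) (hP.add_mem h.2 h'.2)⟩⟩

instance (hP : IsIdeal P) : RieszMVAlgebra (QuotientByIdeal hP) where
  nsmul := nsmulRec
  neg := Quotient.map neg fun x y h => by
    refine ⟨?_, ?_⟩ <;> rw [neg_tsub_neg]
    exacts [h.2, h.1]
  -- Ideals need no closure condition for scalars, because `r • x ≤ x`.
  smul r := Quotient.map (r • ·) fun x y h => by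
    refine ⟨?_, ?_⟩ <;> rw [← smul_tsub]
    exacts [hP.mem_of_le (smul_le_self _ _) h.1, hP.mem_of_le (smul_le_self _ _) h.2]
  add_assoc := by
    rintro ⟨x⟩ ⟨y⟩ ⟨z⟩
    exact congrArg (mk hP) (add_assoc x y z)
  zero_add := by
    rintro ⟨x⟩
    exact congrArg (mk hP) (zero_add x)
  add_zero := by
    rintro ⟨x⟩
    exact congrArg (mk hP) (add_zero x)
  add_comm := by
    rintro ⟨x⟩ ⟨y⟩
    exact congrArg (mk hP) (add_comm x y)
  neg_neg := by
    rintro ⟨x⟩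
    exact congrArg (mk hP) (MVAlgebra.neg_neg x)
  neg_zero_add := by
    rintro ⟨x⟩
    exact congrArg (mk hP) (MVAlgebra.neg_zero_add x)
  neg_add_comm := by
    rintro ⟨x⟩ ⟨y⟩
    exact congrArg (mk hP) (MVAlgebra.neg_add_comm x y)
  smul_odot_neg := by
    rintro r ⟨x⟩ ⟨y⟩
    exact congrArg (mk hP) (RieszMVAlgebra.smul_odot_neg r x y)
  odot_neg_smul := by
    rintro r q ⟨x⟩
    exact congrArg (mk hP) (RieszMVAlgebra.odot_neg_smul r q x)
  smul_smul := by
    rintro r q ⟨x⟩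
    exact congrArg (mk hP) (RieszMVAlgebra.smul_smul r q x)
  one_smul := by
    rintro ⟨x⟩
    exact congrArg (mk hP) (RieszMVAlgebra.one_smul x)

end QuotientByIdeal

/-- Each nonzero element of a Riesz MV-algebra is nonzero in some totally ordered quotient. -/
theorem exists_hom_chain_ne_zero {t : R} (ht : t ≠ 0) :
    ∃ (Q : Type u) (_ : RieszMVAlgebra Q) (φ : RieszMVHom R Q),
      (∀ x y : Q, x ≤ y ∨ y ≤ x) ∧ φ.toFun t ≠ 0 := by
  obtain ⟨P, hP⟩ := exists_maximal_ideal_notMem ht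
  have hI := hP.1.1
  refine ⟨QuotientByIdeal hI, inferInstance, ⟨QuotientByIdeal.mk hI, rfl, fun _ _ => rfl,
    fun _ => rfl, fun _ _ => rfl⟩, ?_, fun h => hP.1.2 ?_⟩
  · have key : ∀ x y : R, x ⊖ y ∈ P → QuotientByIdeal.mk hI x ≤ QuotientByIdeal.mk hI y := by
      intro x y h
      refine Quotient.sound (s := hI.setoid) (a := x ⊖ y) (b := 0) ⟨?_, ?_⟩
      · exact hI.mem_of_le (tsub_le_self _ _) h
      · exact hI.mem_of_le (tsub_le_self _ _) hI.zero_mem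
    rintro ⟨x⟩ ⟨y⟩
    exact (tsub_mem_or_tsub_mem_of_maximal hP x y).imp (key x y) (key y x)
  · have h1 : t ⊖ 0 ∈ P := (Quotient.exact (s := hI.setoid) (a := t) (b := 0) h).1
    rwa [tsub, add_zero, MVAlgebra.neg_neg] at h1

end Quotient

end RieszMVAlgebra

namespace RieszMVAlgebra

/-! ### Linear relations and a positive functional by Hahn-Banach -/

section LinearFunctional

open MVAlgebra

local infixl:65 " ⊖ " => MVAlgebra.tsub
attribute [local instance] MVAlgebra.partialOrder MVAlgebra.lattice

variable {R : Type u} [RieszMVAlgebra R] {ι : Type w}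

/-- The nearest point of `[0,1]`. -/
noncomputable def clip (r : ℝ) : unitInterval := Set.projIcc 0 1 zero_le_one r

theorem coe_clip {r : ℝ} (h0 : 0 ≤ r) (h1 : r ≤ 1) : (clip r : ℝ) = r := by
  rw [clip, Set.projIcc_of_mem zero_le_one ⟨h0, h1⟩]

theorem clip_zero : clip 0 = 0 := Subtype.ext (coe_clip le_rfl zero_le_one)

theorem clip_one : clip 1 = 1 := Subtype.ext (coe_clip zero_le_one le_rfl)

theorem clip_add_smul {r q : ℝ} (hr : 0 ≤ r) (hq : 0 ≤ q) (h : r + q ≤ 1) (x : R) :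
    clip (r + q) • x = clip r • x + clip q • x :=
  add_smul_of_coe_eq (by
    rw [coe_clip hr (by linarith), coe_clip hq (by linarith), coe_clip (by linarith) h]) x

theorem clip_mul_smul {r q : ℝ} (hr : 0 ≤ r) (hr1 : r ≤ 1) (hq : 0 ≤ q) (hq1 : q ≤ 1) (x : R) :
    clip (r * q) • x = clip r • clip q • x := by
  rw [RieszMVAlgebra.smul_smul]
  congr 1
  apply Subtype.ext
  rw [Set.Icc.coe_mul, coe_clip hr hr1, coe_clip hq hq1,
    coe_clip (mul_nonneg hr hq) (mul_le_one₀ hr1 hq hq1)]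

/-- The combination of the elements `b i` with the coefficients `c i`; it is meaningful for
nonnegative coefficients with sum at most `1`. -/
noncomputable def comb (b : ι → R) (s : Finset ι) (c : ι → ℝ) : R := ∑ i ∈ s, clip (c i) • b i

variable {b : ι → R} {s : Finset ι} {c d : ι → ℝ}

theorem comb_add (hc : 0 ≤ c) (hd : 0 ≤ d) (h : ∀ i ∈ s, c i + d i ≤ 1) :
    comb b s (c + d) = comb b s c + comb b s d := by
  rw [comb, comb, comb, ← Finset.sum_add_distrib]
  exact Finset.sum_congr rfl fun i hi => clip_add_smul (hc i) (hd i) (h i hi) _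

/-- Each `b i` is at most the top element. The bound turns the numerical condition "total
coefficient at most `1`" into the absence of truncation. -/
theorem comb_le (hc : 0 ≤ c) (h : ∑ i ∈ s, c i ≤ 1) :
    comb b s c ≤ clip (∑ i ∈ s, c i) • neg 0 := by
  classical
  induction s using Finset.induction_on with
  | empty => rw [comb, Finset.sum_empty]; exact zero_le _
  | insert a s ha ih =>
    have hs : 0 ≤ ∑ i ∈ s, c i := Finset.sum_nonneg fun i _ => hc i
    have := hc a
    simp only [Pi.zero_apply] at this
    rw [Finset.sum_insert ha] at h
    rw [comb, Finset.sum_insert ha, Finset.sum_insert ha, clip_add_smul this hs h]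
    exact add_le_add' (smul_le_smul_left _ (le_neg_zero _)) (ih (by linarith))

theorem comb_le_neg_comb (hc : 0 ≤ c) (hd : 0 ≤ d) {t : Finset ι}
    (h : ∑ i ∈ s, c i + ∑ i ∈ t, d i ≤ 1) : comb b s c ≤ neg (comb b t d) := by
  have h1 : 0 ≤ ∑ i ∈ s, c i := Finset.sum_nonneg fun i _ => hc i
  have h2 : 0 ≤ ∑ i ∈ t, d i := Finset.sum_nonneg fun i _ => hd i
  refine le_neg_of_le_smul ?_ (comb_le hc (by linarith)) (comb_le hd (by linarith))
  rwa [coe_clip h1 (by linarith), coe_clip h2 (by linarith)]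

theorem comb_smul {r : ℝ} (hr : 0 ≤ r) (hr1 : r ≤ 1) (hc : 0 ≤ c) (h : ∑ i ∈ s, c i ≤ 1) :
    comb b s (r • c) = clip r • comb b s c := by
  classical
  induction s using Finset.induction_on with
  | empty => rw [comb, comb, Finset.sum_empty, Finset.sum_empty, smul_zero]
  | insert a s ha ih =>
    have hs : 0 ≤ ∑ i ∈ s, c i := Finset.sum_nonneg fun i _ => hc i
    have ha0 := hc a
    simp only [Pi.zero_apply] at ha0
    have h' := h
    rw [Finset.sum_insert ha] at h'
    have h1 := comb_le_neg_comb (b := b) (s := {a}) (t := s) hc hc (by rwa [Finset.sum_singleton])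
    have ih' := ih (by linarith)
    rw [comb, Finset.sum_singleton] at h1
    rw [comb] at ih' h1
    rw [comb, comb, Finset.sum_insert ha, Finset.sum_insert ha, smul_add_of_le_neg _ h1, ih',
      Pi.smul_apply, smul_eq_mul, clip_mul_smul hr hr1 ha0 (by linarith)]
    rfl

theorem smul_eq_zero_of_comb_eq_zero (h : comb b s c = 0) {i : ι} (hi : i ∈ s) :
    clip (c i) • b i = 0 := by
  classical
  rw [← MVAlgebra.le_zero_iff, ← h, comb, ← Finset.add_sum_erase _ _ hi]
  exact le_add_right _ _

variable [Fintype ι]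

theorem le_one_of_sum_le_one (hc : 0 ≤ c) (h : ∑ i, c i ≤ 1) (i : ι) : c i ≤ 1 :=
  (Finset.single_le_sum (fun j _ => hc j) (Finset.mem_univ i)).trans h

/-- The linear relations between the elements `b i`. -/
def relations (b : ι → R) : Submodule ℝ (ι → ℝ) where
  -- There are no negatives in `R` and sums truncate, so a real relation is read as an equality of
  -- two combinations with nonnegative coefficients, after scaling by `ε` until both totals are at
  -- most `1`.
  carrier := {q | ∃ ε : ℝ, 0 < ε ∧ ∃ c d : ι → ℝ, 0 ≤ c ∧ 0 ≤ d ∧ ∑ i, c i ≤ 1 ∧ ∑ i, d i ≤ 1 ∧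
    ε • q = c - d ∧ comb b .univ c = comb b .univ d}
  zero_mem' := ⟨1, one_pos, 0, 0, le_rfl, le_rfl, by simp, by simp, by simp, rfl⟩
  smul_mem' := by
    rintro r q ⟨ε, hε, c, d, hc, hd, hc1, hd1, hq, h⟩
    rcases lt_trichotomy r 0 with hr | rfl | hr
    · refine ⟨ε / -r, div_pos hε (neg_pos.2 hr), d, c, hd, hc, hd1, hc1, ?_, h.symm⟩
      rw [_root_.smul_smul, div_mul_eq_mul_div, div_neg, mul_div_assoc, div_self hr.ne, mul_one,
        _root_.neg_smul, hq, neg_sub]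
    · exact ⟨1, one_pos, 0, 0, le_rfl, le_rfl, by simp, by simp, by simp, rfl⟩
    · refine ⟨ε / r, div_pos hε hr, c, d, hc, hd, hc1, hd1, ?_, h⟩
      rw [_root_.smul_smul, div_mul_cancel₀ _ hr.ne', hq]
  add_mem' := by
    rintro q q' ⟨ε, hε, c, d, hc, hd, hc1, hd1, hq, h⟩
      ⟨ε', hε', c', d', hc', hd', hc1', hd1', hq', h'⟩
    have hs : 0 < ε + ε' := add_pos hε hε'
    -- Convex weights chosen so that `α * ε = β * ε'`: the convex combination of the two witnesses
    -- then represents a positive multiple of `q + q'`.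
    set α := ε' / (ε + ε') with hα
    set β := ε / (ε + ε') with hβ
    have hα0 : 0 ≤ α := div_nonneg hε'.le hs.le
    have hβ0 : 0 ≤ β := div_nonneg hε.le hs.le
    have hαβ : α + β = 1 := by rw [hα, hβ]; field_simp; ring
    have sum_le : ∀ {x y : ι → ℝ}, ∑ i, x i ≤ 1 → ∑ i, y i ≤ 1 → ∑ i, (α • x + β • y) i ≤ 1 := by
      intro x y hx hy
      simp only [Pi.add_apply, Pi.smul_apply, smul_eq_mul, Finset.sum_add_distrib,
        ← Finset.mul_sum]
      nlinarith
    have nonneg : ∀ {x y : ι → ℝ}, 0 ≤ x → 0 ≤ y → 0 ≤ α • x + β • y := fun hx hy =>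
      add_nonneg (smul_nonneg hα0 hx) (smul_nonneg hβ0 hy)
    have comb_eq : ∀ {x y : ι → ℝ}, 0 ≤ x → 0 ≤ y → ∑ i, x i ≤ 1 → ∑ i, y i ≤ 1 →
        comb b .univ (α • x + β • y) = clip α • comb b .univ x + clip β • comb b .univ y := by
      intro x y hx hy hx1 hy1
      rw [comb_add (smul_nonneg hα0 hx) (smul_nonneg hβ0 hy)
        (fun i _ => le_one_of_sum_le_one (nonneg hx hy) (sum_le hx1 hy1) i),
        comb_smul hα0 (by linarith) hx hx1, comb_smul hβ0 (by linarith) hy hy1]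
    refine ⟨ε * ε' / (ε + ε'), by positivity, α • c + β • c', α • d + β • d', nonneg hc hc',
      nonneg hd hd', sum_le hc1 hc1', sum_le hd1 hd1', ?_, ?_⟩
    · have e1 : ε * ε' / (ε + ε') = α * ε := by rw [hα]; ring
      have e2 : ε * ε' / (ε + ε') = β * ε' := by rw [hβ]; ring
      rw [smul_add, e1, mul_smul, hq, ← e1, e2, mul_smul, hq', smul_sub, smul_sub]
      abel
    · rw [comb_eq hc hc' hc1 hc1', comb_eq hd hd' hd1 hd1', h, h']

/-- With `q ≥ 0` the relation reads `ε • q + d = c`, an untruncated sum. Cancelling the combination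
of `d` leaves a zero combination of `ε • q`, all of whose terms must vanish. -/
theorem eq_zero_of_mem_relations {q : ι → ℝ} (hq0 : 0 ≤ q) (hq : q ∈ relations b) {i : ι}
    (hi : 0 < q i) : b i = 0 := by
  obtain ⟨ε, hε, c, d, hc, hd, hc1, hd1, hqcd, h⟩ := hq
  have hq0' : 0 ≤ ε • q := smul_nonneg hε.le hq0
  have hadd : ε • q + d = c := by rw [hqcd, sub_add_cancel]
  have hsum : ∑ i, (ε • q) i + ∑ i, d i ≤ 1 := by
    rw [← Finset.sum_add_distrib]
    exact (Finset.sum_congr rfl fun i _ => congrFun hadd i).trans_le hc1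
  have h0 := comb_le_neg_comb (b := b) (s := .univ) (t := .univ) hq0' hd hsum
  have h1 : comb b .univ (ε • q) + comb b .univ d = comb b .univ d := by
    rw [← comb_add hq0' hd, hadd, h]
    intro i _
    exact (congrFun hadd i).le.trans (le_one_of_sum_le_one hc hc1 i)
  have h2 : comb b .univ (ε • q) = 0 := by
    rw [← add_tsub_cancel h0, h1, MVAlgebra.tsub_self]
  have hle : (ε • q) i ≤ 1 := by
    have := congrFun hadd i
    simp only [Pi.add_apply] at this
    have h3 := hd i
    simp only [Pi.zero_apply] at h3
    linarith [le_one_of_sum_le_one hc hc1 i]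
  refine smul_eq_zero ?_ (smul_eq_zero_of_comb_eq_zero h2 (Finset.mem_univ i))
  rw [coe_clip (hq0' i) hle]
  exact mul_pos hε hi

/-- The face of the standard simplex supported on the nonzero `b i` is compact and convex, and by
`eq_zero_of_mem_relations` it misses the subspace of relations. Strict separation gives the
functional, up to sign. -/
theorem exists_linearMap_pos (b : ι → R) [DecidableEq ι] :
    ∃ f : (ι → ℝ) →ₗ[ℝ] ℝ, (∀ i, b i ≠ 0 → 0 < f (Pi.single i 1)) ∧ ∀ q ∈ relations b, f q = 0 := by
  set T : Set (ι → ℝ) := stdSimplex ℝ ι ∩ {q | ∀ i, b i = 0 → q i = 0} with hT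
  have hTc : IsCompact T := by
    refine (isCompact_stdSimplex ℝ ι).inter_right ?_
    simp only [Set.ofPred_forall]
    exact isClosed_iInter fun i => isClosed_iInter fun _ =>
      isClosed_eq (continuous_apply i) continuous_const
  have hTconv : Convex ℝ T := by
    refine (convex_stdSimplex ℝ ι).inter ?_
    intro x hx y hy α β _ _ _ i hi
    simp [hx i hi, hy i hi]
  have hdisj : Disjoint T (relations b : Set (ι → ℝ)) := by
    rw [Set.disjoint_left]
    rintro q ⟨⟨hq0, hq1⟩, hq⟩ hqr
    have : ∑ i, q i = 0 := Finset.sum_eq_zero fun i _ => by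
      by_contra hne
      exact hne (hq i (eq_zero_of_mem_relations hq0 hqr (lt_of_le_of_ne (hq0 i) (Ne.symm hne))))
    linarith
  obtain ⟨f, u, v, hfT, huv, hfN⟩ := geometric_hahn_banach_compact_closed hTconv hTc
    (relations b).convex (Submodule.closed_of_finiteDimensional _) hdisj
  have hv : v < 0 := by simpa using hfN 0 (relations b).zero_mem
  refine ⟨-f.toLinearMap, fun i hi => ?_, fun q hq => ?_⟩
  · have := hfT (Pi.single i 1) ⟨single_mem_stdSimplex ℝ i, fun j hj => by
      rw [Pi.single_eq_of_ne]
      rintro rfl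
      exact hi hj⟩
    simp only [LinearMap.neg_apply, ContinuousLinearMap.coe_coe]
    linarith
  · by_contra hne
    simp only [LinearMap.neg_apply, ContinuousLinearMap.coe_coe, neg_eq_zero] at hne
    -- A functional bounded below on a subspace vanishes there: otherwise this multiple of `q`
    -- attains the excluded value `v`.
    have := hfN ((v / f q) • q) ((relations b).smul_mem _ hq)
    rw [map_smul, smul_eq_mul, div_mul_cancel₀ _ hne] at this
    exact lt_irrefl _ this

theorem comb_single [DecidableEq ι] (i : ι) (r : ℝ) :
    comb b .univ (Pi.single i r) = clip r • b i := by
  rw [comb, Finset.sum_eq_single i, Pi.single_eq_same]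
  · intro j _ hj
    rw [Pi.single_eq_of_ne hj, clip_zero, zero_smul]
  · exact fun h => absurd (Finset.mem_univ i) h

theorem add_mem_relations [DecidableEq ι] {i j k : ι} (h : b i ≤ neg (b j)) (hk : b k = b i + b j) :
    (Pi.single k 1 - (Pi.single i 1 + Pi.single j 1) : ι → ℝ) ∈ relations b := by
  have hp : ∀ i : ι, (0 : ι → ℝ) ≤ Pi.single i (1 / 2) := fun i =>
    Pi.single_nonneg.2 (by norm_num)
  -- Halving brings the total coefficient of the right side from `2` down to the permitted `1`.
  refine ⟨1 / 2, by norm_num, Pi.single k (1 / 2), Pi.single i (1 / 2) + Pi.single j (1 / 2), hp k,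
    add_nonneg (hp i) (hp j), ?_, ?_, ?_, ?_⟩
  · rw [Finset.sum_pi_single']; norm_num
  · simp only [Pi.add_apply, Finset.sum_add_distrib, Finset.sum_pi_single']; norm_num
  · rw [smul_sub, smul_add, ← Pi.single_smul, ← Pi.single_smul, ← Pi.single_smul, smul_eq_mul,
      mul_one]
  · rw [comb_add (hp i) (hp j), comb_single, comb_single, comb_single, hk, smul_add_of_le_neg _ h]
    intro l _
    simp only [Pi.single_apply]
    split_ifs <;> norm_num

theorem smul_mem_relations [DecidableEq ι] {i k : ι} {r : unitInterval} (hk : b k = r • b i) :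
    (Pi.single k 1 - Pi.single i (r : ℝ) : ι → ℝ) ∈ relations b := by
  refine ⟨1, one_pos, Pi.single k 1, Pi.single i r, Pi.single_nonneg.2 zero_le_one,
    Pi.single_nonneg.2 r.2.1, ?_, ?_, ?_, ?_⟩
  · rw [Finset.sum_pi_single']; norm_num
  · rw [Finset.sum_pi_single']; simpa using r.2.2
  · rw [_root_.one_smul]
  · rw [comb_single, comb_single, clip_one, RieszMVAlgebra.one_smul, hk]
    congr 1
    exact Subtype.ext (coe_clip r.2.1 r.2.2).symm

/-- On a finite set of elements there is a linear functional that is positive at the nonzero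
elements. -/
theorem exists_pos_additive_on (S : Finset R) :
    ∃ h : R → ℝ, (∀ x ∈ S, x ≠ 0 → 0 < h x) ∧
      (∀ x ∈ S, ∀ y ∈ S, x + y ∈ S → x ≤ neg y → h (x + y) = h x + h y) ∧
      ∀ (r : unitInterval), ∀ x ∈ S, r • x ∈ S → h (r • x) = r * h x := by
  classical
  obtain ⟨f, hpos, hrel⟩ := exists_linearMap_pos (fun x : S => (x : R))
  -- The value `0` outside `S` is arbitrary; the three properties concern only elements of `S`.
  refine ⟨fun x => if hx : x ∈ S then f (Pi.single ⟨x, hx⟩ 1) else 0, ?_, ?_, ?_⟩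
  · intro x hx h0
    simp only [hx, dif_pos]
    exact hpos ⟨x, hx⟩ h0
  · intro x hx y hy hxy h
    simp only [hx, hy, hxy, dif_pos]
    have := hrel _ (add_mem_relations (b := fun x : S => (x : R)) (i := ⟨x, hx⟩) (j := ⟨y, hy⟩)
      (k := ⟨x + y, hxy⟩) h rfl)
    rwa [map_sub, map_add, sub_eq_zero] at this
  · intro r x hx hrx
    simp only [hx, hrx, dif_pos]
    have := hrel _ (smul_mem_relations (b := fun x : S => (x : R)) (i := ⟨x, hx⟩)
      (k := ⟨r • x, hrx⟩) (r := r) rfl)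
    have e : (Pi.single (⟨x, hx⟩ : S) (r : ℝ) : S → ℝ) = (r : ℝ) • Pi.single ⟨x, hx⟩ 1 := by
      rw [← Pi.single_smul, smul_eq_mul, mul_one]
    rwa [map_sub, e, map_smul, smul_eq_mul, sub_eq_zero] at this

end LinearFunctional

end RieszMVAlgebra

namespace RieszMVAlgebra

/-! ### Terms and completeness of `[0,1]` for equations -/

section Terms

open MVAlgebra

local infixl:65 " ⊖ " => MVAlgebra.tsub
attribute [local instance] MVAlgebra.partialOrder MVAlgebra.lattice

/-- Terms in the language of Riesz MV-algebras. -/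
inductive RieszTerm (ι : Type w) : Type w
  | var (i : ι) : RieszTerm ι
  | zero : RieszTerm ι
  | add (s t : RieszTerm ι) : RieszTerm ι
  | neg (t : RieszTerm ι) : RieszTerm ι
  | smul (r : unitInterval) (t : RieszTerm ι) : RieszTerm ι

namespace RieszTerm

variable {ι : Type w} {R : Type u} [RieszMVAlgebra R] {Q : Type v} [RieszMVAlgebra Q]

/-- The value of a term. -/
def eval (a : ι → R) : RieszTerm ι → R
  | var i => a i
  | zero => 0
  | add s t => eval a s + eval a t
  | neg t => MVAlgebra.neg (eval a t)
  | smul r t => r • eval a t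

theorem map_eval (φ : RieszMVHom R Q) (a : ι → R) (t : RieszTerm ι) :
    φ.toFun (eval a t) = eval (fun i => φ.toFun (a i)) t := by
  induction t with
  | var i => rfl
  | zero => exact φ.map_zero
  | add s t hs ht => rw [eval, φ.map_add, hs, ht, eval]
  | neg t ht => rw [eval, φ.map_neg, ht, eval]
  | smul r t ht => rw [eval, φ.map_smul, ht, eval]

/-- The term for the difference `s ⊖ t`. -/
def tsub (s t : RieszTerm ι) : RieszTerm ι := neg (add (neg s) t)

theorem eval_tsub (a : ι → R) (s t : RieszTerm ι) : eval a (tsub s t) = eval a s ⊖ eval a t := rfl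

open Classical in
/-- A finite set of elements that controls the evaluation of a term. -/
noncomputable def support (a : ι → R) : RieszTerm ι → Finset R
  | var i => {a i, MVAlgebra.neg (a i)}
  | zero => ∅
  -- The complement of the sum forces its functional value to be at most `1`; the last two elements
  -- decompose `eval a s` when the sum truncates.
  | add s t => support a s ∪ support a t ∪ {eval a s, eval a t, eval a s + eval a t,
      MVAlgebra.neg (eval a s + eval a t), MVAlgebra.neg (eval a t),
      eval a s ⊖ MVAlgebra.neg (eval a t)}
  | neg t => support a t ∪ {eval a t, MVAlgebra.neg (eval a t)}
  | smul r t => support a t ∪ {eval a t, r • eval a t}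

/-- By induction `h` commutes with evaluation. Totality is needed only for sums: either `x ≤ neg y`
and `h` is additive, or `x = (x ⊖ neg y) + neg y` is untruncated, giving `h x + h y ≥ 1`, so both
sides truncate to `1`. -/
theorem coe_eval_eq (hR : ∀ x y : R, x ≤ y ∨ y ≤ x) {S : Finset R} (h0 : 0 ∈ S)
    (h1 : MVAlgebra.neg 0 ∈ S) {h : R → ℝ} (hnonneg : ∀ x ∈ S, 0 ≤ h x)
    (hone : h (MVAlgebra.neg 0) = 1)
    (hadd : ∀ x ∈ S, ∀ y ∈ S, x + y ∈ S → x ≤ MVAlgebra.neg y → h (x + y) = h x + h y)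
    (hsmul : ∀ (r : unitInterval), ∀ x ∈ S, r • x ∈ S → h (r • x) = r * h x)
    (a : ι → R) (t : RieszTerm ι) (ht : support a t ⊆ S) :
    ((eval (fun i => clip (h (a i))) t : unitInterval) : ℝ) = h (eval a t) := by
  have hneg : ∀ x ∈ S, MVAlgebra.neg x ∈ S → h (MVAlgebra.neg x) = 1 - h x := by
    intro x hx hx'
    have := hadd _ hx' _ hx (by rwa [neg_add_self]) le_rfl
    rw [neg_add_self, hone] at this
    linarith
  induction t with
  | var i =>
    simp only [support, Finset.insert_subset_iff, Finset.singleton_subset_iff] at ht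
    have := hnonneg _ ht.2
    rw [hneg _ ht.1 ht.2] at this
    exact coe_clip (hnonneg _ ht.1) (by linarith)
  | zero =>
    have := hadd 0 h0 0 h0 (by rwa [add_zero]) (zero_le _)
    rw [add_zero] at this
    rw [eval, eval, eq_comm]
    exact (by linarith : h 0 = 0)
  | add s t hs ht' =>
    simp only [support, Finset.insert_subset_iff, Finset.singleton_subset_iff,
      Finset.union_subset_iff] at ht
    obtain ⟨⟨hs', ht⟩, hx, hy, hxy, hnxy, hny, hd⟩ := ht
    rw [eval, eval, unitInterval.coe_mv_add, hs hs', ht' ht]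
    rcases hR (eval a s) (MVAlgebra.neg (eval a t)) with hle | hle
    · have := hnonneg _ hnxy
      rw [hneg _ hxy hnxy, hadd _ hx _ hy hxy hle] at this
      rw [hadd _ hx _ hy hxy hle, min_eq_left (by linarith)]
    · have e := tsub_add_cancel hle
      have := hadd _ hd _ hny (by rwa [e]) (tsub_le_neg _ _)
      rw [e, hneg _ hy hny] at this
      have := hnonneg _ hd
      rw [add_eq_neg_zero hle, hone, min_eq_right (by linarith)]
  | neg t ht' =>
    simp only [support, Finset.insert_subset_iff, Finset.singleton_subset_iff,
      Finset.union_subset_iff] at ht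
    rw [eval, eval, unitInterval.coe_mv_neg, ht' ht.1, hneg _ ht.2.1 ht.2.2]
  | smul r t ht' =>
    simp only [support, Finset.insert_subset_iff, Finset.singleton_subset_iff,
      Finset.union_subset_iff] at ht
    rw [eval, eval, hsmul _ _ ht.2.1 ht.2.2, ← ht' ht.1]
    rfl

theorem eval_eq_zero_of_total (hR : ∀ x y : R, x ≤ y ∨ y ≤ x) {t : RieszTerm ι}
    (ht : ∀ x : ι → unitInterval, eval x t = 0) (a : ι → R) : eval a t = 0 := by
  classical
  by_contra hne
  set S : Finset R := support a t ∪ {0, MVAlgebra.neg 0, eval a t} with hS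
  obtain ⟨h, hpos, hadd, hsmul⟩ := exists_pos_additive_on S
  have h0 : 0 ∈ S := by simp [hS]
  have h1 : MVAlgebra.neg 0 ∈ S := by simp [hS]
  have he : eval a t ∈ S := by simp [hS]
  have hone : 0 < h (MVAlgebra.neg 0) := by
    refine hpos _ h1 fun h => hne ?_
    rw [← MVAlgebra.le_zero_iff, ← h]
    exact le_neg_zero _
  have hzero : h 0 = 0 := by
    have := hadd 0 h0 0 h0 (by rwa [add_zero]) (zero_le _)
    rw [add_zero] at this
    linarith
  -- The normalized functional sends the top to `1`, so the term's value at the clipped point is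
  -- positive if `eval a t` is nonzero, against `ht`.
  have key := coe_eval_eq hR (S := S) (h := fun x => h x / h (MVAlgebra.neg 0)) h0 h1
    (fun x hx => div_nonneg (by
      by_cases hx0 : x = 0
      · rw [hx0, hzero]
      · exact (hpos x hx hx0).le) hone.le) (div_self hone.ne')
    (fun x hx y hy hxy hle => by rw [hadd x hx y hy hxy hle, add_div])
    (fun r x hx hrx => by rw [hsmul r x hx hrx, mul_div_assoc]) a t Finset.subset_union_left
  rw [ht] at key
  exact (div_pos (hpos _ he hne) hone).ne key

/-- An equation `t = 0` that holds in `[0,1]` holds in all Riesz MV-algebras. -/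
theorem eval_eq_zero {t : RieszTerm ι} (ht : ∀ x : ι → unitInterval, eval x t = 0) (a : ι → R) :
    eval a t = 0 := by
  by_contra hne
  obtain ⟨Q, _, φ, hQ, hφ⟩ := exists_hom_chain_ne_zero hne
  rw [map_eval] at hφ
  exact hφ (eval_eq_zero_of_total hQ ht _)

/-- An equation that holds in `[0,1]` holds in all Riesz MV-algebras. -/
theorem eval_eq_eval {s t : RieszTerm ι} (h : ∀ x : ι → unitInterval, eval x s = eval x t)
    (a : ι → R) : eval a s = eval a t := by
  refine le_antisymm (le_iff_tsub.2 ?_) (le_iff_tsub.2 ?_) <;> rw [← eval_tsub] <;>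
    refine eval_eq_zero (fun x => ?_) a <;> rw [eval_tsub, h x, MVAlgebra.tsub_self]

/-- The values of the terms are a subalgebra. -/
theorem isSubalgebra_range_eval (a : ι → R) : IsSubalgebra (Set.range (eval a)) where
  zero_mem := ⟨zero, rfl⟩
  add_mem := by
    rintro _ ⟨s, rfl⟩ _ ⟨t, rfl⟩
    exact ⟨add s t, rfl⟩
  neg_mem := by
    rintro _ ⟨t, rfl⟩
    exact ⟨neg t, rfl⟩
  smul_mem := by
    rintro r _ ⟨t, rfl⟩
    exact ⟨smul r t, rfl⟩

end RieszTerm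

end Terms

end RieszMVAlgebra

/-! ### Affine components along a segment -/

/-- If a continuous function on `[0,1]` agrees at each point with one of finitely many affine
functions, then one of them is above it at `0` and below it at `1`. -/
theorem exists_affine_ge_le {ι : Type*} (Q : Finset ι) (α β : ι → ℝ) {φ : ℝ → ℝ}
    (hφ : Continuous φ) (h : ∀ s ∈ Set.Icc (0 : ℝ) 1, ∃ i ∈ Q, φ s = α i + s * β i) :
    ∃ i ∈ Q, φ 0 ≤ α i ∧ α i + β i ≤ φ 1 := by
  by_contra! hcon
  -- By the contrary assumption each component ending at or below `φ 1` starts strictly below `φ 0`;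
  -- finiteness makes the gap uniform.
  obtain ⟨ε, hε, hgap⟩ : ∃ ε : ℝ, 0 < ε ∧ ∀ i ∈ Q, α i + β i ≤ φ 1 → α i + ε ≤ φ 0 := by
    have : ∀ᶠ ε in nhdsWithin (0 : ℝ) (Set.Ioi 0), ∀ i ∈ Q, α i + β i ≤ φ 1 → α i + ε ≤ φ 0 := by
      rw [Filter.eventually_all_finset]
      intro i hi
      by_cases hle : α i + β i ≤ φ 1
      · have hlt : α i < φ 0 := not_le.1 fun h' => (hcon i hi h').not_ge hle
        filter_upwards [nhdsWithin_le_nhds (Iio_mem_nhds (sub_pos.2 hlt))] with ε hε _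
        have : ε < φ 0 - α i := hε
        linarith
      · exact Filter.Eventually.of_forall fun _ h' => absurd h' hle
    obtain ⟨ε, h1, h2⟩ := (this.and self_mem_nhdsWithin).exists
    exact ⟨ε, h2, h1⟩
  -- The line from `φ 0 - ε` to `φ 1`. At the first point `z` where `φ` is not above it, a component
  -- agreeing with `φ` arbitrarily close on the left crosses it downwards. That component starts
  -- above `φ 0 - ε` and ends at or below `φ 1`, contradicting the gap.
  set m : ℝ → ℝ := fun s => φ 0 - ε + s * (φ 1 - φ 0 + ε) with hm
  have hmc : Continuous m := by fun_prop
  set Z : Set ℝ := Set.Icc 0 1 ∩ {s | φ s ≤ m s} with hZ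
  have hZc : IsClosed Z := isClosed_Icc.inter (isClosed_le hφ hmc)
  have hZne : Z.Nonempty := ⟨1, ⟨zero_le_one, le_rfl⟩, by simp [hm]⟩
  have hZb : BddBelow Z := ⟨0, fun s hs => hs.1.1⟩
  set z := sInf Z with hz
  have hzZ : z ∈ Z := hZc.csInf_mem hZne hZb
  have hz0 : 0 < z := by
    refine lt_of_le_of_ne hzZ.1.1 fun h0 => ?_
    have h2 : φ z ≤ m z := hzZ.2
    rw [← h0] at h2
    simp only [hm, zero_mul, add_zero] at h2
    linarith
  have hpos : ∀ s ∈ Set.Ico 0 z, m s < φ s := by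
    intro s hs
    by_contra hle
    exact hs.2.not_ge (csInf_le hZb ⟨⟨hs.1, hs.2.le.trans hzZ.1.2⟩, not_lt.1 hle⟩)
  have hev : ∀ᶠ s in nhdsWithin z (Set.Iio z), s ∈ Set.Ico 0 z := by
    filter_upwards [self_mem_nhdsWithin, nhdsWithin_le_nhds (Ioi_mem_nhds hz0)] with s h1 h2
    exact ⟨le_of_lt h2, h1⟩
  obtain ⟨i, hi, hfreq⟩ : ∃ i ∈ Q, ∃ᶠ s in nhdsWithin z (Set.Iio z), φ s = α i + s * β i := by
    by_contra! hno
    rw [← Filter.eventually_all_finset] at hno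
    obtain ⟨s, h1, h2⟩ := (hno.and hev).exists
    obtain ⟨i, hi, hs⟩ := h s ⟨h2.1, h2.2.le.trans hzZ.1.2⟩
    exact h1 i hi hs
  have hzi : φ z = α i + z * β i := by
    have hcl : IsClosed {s | φ s = α i + s * β i} := isClosed_eq hφ (by fun_prop)
    exact hcl.mem_of_frequently_of_tendsto hfreq
      (Filter.tendsto_id.mono_left nhdsWithin_le_nhds)
  obtain ⟨s, hs, hsI⟩ := (hfreq.and_eventually hev).exists
  have h1 := hpos s hsI
  have h2 : φ z ≤ m z := hzZ.2
  rw [hs] at h1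
  rw [hzi] at h2
  simp only [hm] at h1 h2
  have hslope : β i < φ 1 - φ 0 + ε := by
    have := hsI.2
    by_contra hge
    nlinarith
  have h3 : α i + β i ≤ φ 1 := by
    have := hzZ.1.2
    nlinarith
  have h4 := hgap i hi h3
  have := hsI.1
  nlinarith

namespace PL

/-! ### Maximum-minimum representation and generation by the projections -/

section Generation

open RieszMVAlgebra

local infixl:65 " ⊖ " => MVAlgebra.tsub

variable {n : ℕ}

/-- Between any two points, one of the affine components of a piecewise linear function is above
it at the first and below it at the second point. -/
theorem exists_component_ge_le {f : (Fin n → unitInterval) → unitInterval} (hf : Continuous f)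
    (Q : Finset ((Fin n → ℝ) →ᵃ[ℝ] ℝ))
    (hQ : ∀ x : Fin n → unitInterval, ∃ q ∈ Q, (f x : ℝ) = q (fun i => (x i : ℝ)))
    (y x : Fin n → unitInterval) :
    ∃ q ∈ Q, (f y : ℝ) ≤ q (fun i => (y i : ℝ)) ∧ q (fun i => (x i : ℝ)) ≤ f x := by
  -- The segment from `y` to `x`; clipping only extends it continuously to all real parameters.
  set γ : ℝ → Fin n → unitInterval := fun s i => clip ((y i : ℝ) + s * (x i - y i)) with hγ
  have hγc : Continuous γ := by
    refine continuous_pi fun i => continuous_projIcc.comp (by fun_prop)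
  have hγv : ∀ s ∈ Set.Icc (0 : ℝ) 1, (fun i => (γ s i : ℝ)) =
      AffineMap.lineMap (fun i => (y i : ℝ)) (fun i => (x i : ℝ)) s := by
    intro s hs
    funext i
    have h1 := (y i).2
    have h2 := (x i).2
    have h3 := hs.1
    have h4 := hs.2
    rw [hγ]
    simp only [AffineMap.lineMap_apply_module', Pi.add_apply, Pi.smul_apply, Pi.sub_apply, smul_eq_mul]
    rw [coe_clip]
    · ring
    · nlinarith [h1.1, h1.2, h2.1, h2.2, mul_nonneg h3 h2.1, mul_nonneg (sub_nonneg.2 h4) h1.1]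
    · nlinarith [mul_nonneg h3 (sub_nonneg.2 h2.2), mul_nonneg (sub_nonneg.2 h4) (sub_nonneg.2 h1.2)]
  have h0 : γ 0 = y := by
    funext i
    apply Subtype.ext
    have := congrFun (hγv 0 ⟨le_rfl, zero_le_one⟩) i
    rwa [AffineMap.lineMap_apply_zero] at this
  have h1 : γ 1 = x := by
    funext i
    apply Subtype.ext
    have := congrFun (hγv 1 ⟨zero_le_one, le_rfl⟩) i
    rwa [AffineMap.lineMap_apply_one] at this
  obtain ⟨q, hq, hle⟩ := exists_affine_ge_le Q (fun q => q (fun i => (y i : ℝ)))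
    (fun q => q (fun i => (x i : ℝ)) - q (fun i => (y i : ℝ)))
    (φ := fun s => (f (γ s) : ℝ)) (continuous_subtype_val.comp (hf.comp hγc)) (by
      intro s hs
      obtain ⟨q, hq, h⟩ := hQ (γ s)
      refine ⟨q, hq, ?_⟩
      rw [h, hγv s hs, AffineMap.apply_lineMap, AffineMap.lineMap_apply_module', smul_eq_mul,
        add_comm])
  simp only [h0, h1, add_sub_cancel] at hle
  exact ⟨q, hq, hle⟩

/-- A continuous piecewise linear function is a supremum of infima of its clipped components. -/
theorem exists_eq_sup_inf {f : (Fin n → unitInterval) → unitInterval} (hf : Continuous f)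
    (Q : Finset ((Fin n → ℝ) →ᵃ[ℝ] ℝ))
    (hQ : ∀ x : Fin n → unitInterval, ∃ q ∈ Q, (f x : ℝ) = q (fun i => (x i : ℝ))) :
    ∃ 𝒜 : Finset (Finset ((Fin n → ℝ) →ᵃ[ℝ] ℝ)),
      f = 𝒜.sup fun A => A.inf fun q x => clip (q (fun i => (x i : ℝ))) := by
  classical
  set g : Finset ((Fin n → ℝ) →ᵃ[ℝ] ℝ) → (Fin n → unitInterval) → unitInterval :=
    fun A => A.inf fun q x => clip (q (fun i => (x i : ℝ))) with hg
  have hclip : ∀ x, clip (f x : ℝ) = f x := fun x => Subtype.ext (coe_clip (f x).2.1 (f x).2.2)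
  have hmono : Monotone clip := Set.monotone_projIcc zero_le_one
  refine ⟨{A ∈ Q.powerset | g A ≤ f}, le_antisymm (fun y => ?_)
    (Finset.sup_le fun A hA => (Finset.mem_filter.1 hA).2)⟩
  -- The components at or above `f` at `y`: their clipped infimum is at least `f y` at `y`, and
  -- `exists_component_ge_le` keeps it below `f` everywhere.
  set A := {q ∈ Q | (f y : ℝ) ≤ q (fun i => (y i : ℝ))} with hA
  have hAf : g A ≤ f := fun x => by
    obtain ⟨q, hq, h1, h2⟩ := exists_component_ge_le hf Q hQ y x
    calc g A x ≤ clip (q (fun i => (x i : ℝ))) := by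
          have : g A ≤ fun x : Fin n → unitInterval => clip (q (fun i => (x i : ℝ))) :=
            Finset.inf_le (Finset.mem_filter.2 ⟨hq, h1⟩)
          exact this x
      _ ≤ clip (f x) := hmono h2
      _ = f x := hclip x
  have hmem : A ∈ ({A ∈ Q.powerset | g A ≤ f} : Finset _) :=
    Finset.mem_filter.2 ⟨Finset.mem_powerset.2 (Finset.filter_subset _ _), hAf⟩
  refine le_trans ?_ (Finset.le_sup (f := g) hmem y)
  rw [hg]
  simp only [Finset.inf_apply]
  refine Finset.le_inf fun q hq => ?_
  rw [← hclip y]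
  exact hmono (Finset.mem_filter.1 hq).2

theorem coe_tsub_apply (p q : PL n) (x : Fin n → unitInterval) :
    ((p ⊖ q).1 x : ℝ) = max ((p.1 x : ℝ) - q.1 x) 0 :=
  coe_tsub (p.1 x) (q.1 x)

theorem coe_add_apply (p q : PL n) (x : Fin n → unitInterval) :
    ((p + q).1 x : ℝ) = min ((p.1 x : ℝ) + q.1 x) 1 := rfl

variable {S : Set (PL n)}

theorem tsub_mem (hS : IsSubalgebra S) {p q : PL n} (hp : p ∈ S) (hq : q ∈ S) : p ⊖ q ∈ S :=
  hS.neg_mem _ (hS.add_mem _ (hS.neg_mem _ hp) _ hq)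

/-- The functions that belong to a set of piecewise linear functions. -/
def functions (S : Set (PL n)) : Set ((Fin n → unitInterval) → unitInterval) :=
  {F | ∃ p ∈ S, p.1 = F}

theorem sup_mem_functions (hS : IsSubalgebra S) {F G : (Fin n → unitInterval) → unitInterval}
    (hF : F ∈ functions S) (hG : G ∈ functions S) : F ⊔ G ∈ functions S := by
  obtain ⟨p, hp, rfl⟩ := hF
  obtain ⟨q, hq, rfl⟩ := hG
  refine ⟨p ⊖ q + q, hS.add_mem _ (tsub_mem hS hp hq) _ hq, funext fun x => Subtype.ext ?_⟩
  have h1 := (p.1 x).2.2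
  have h2 := (q.1 x).2.2
  rw [coe_add_apply, coe_tsub_apply, Pi.sup_apply]
  rcases le_total (p.1 x) (q.1 x) with h | h
  · have h' : (p.1 x : ℝ) ≤ q.1 x := h
    rw [sup_eq_right.2 h, max_eq_right (by linarith), zero_add, min_eq_left h2]
  · have h' : (q.1 x : ℝ) ≤ p.1 x := h
    rw [sup_eq_left.2 h, max_eq_left (by linarith), sub_add_cancel, min_eq_left h1]

theorem inf_mem_functions (hS : IsSubalgebra S) {F G : (Fin n → unitInterval) → unitInterval}
    (hF : F ∈ functions S) (hG : G ∈ functions S) : F ⊓ G ∈ functions S := by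
  obtain ⟨p, hp, rfl⟩ := hF
  obtain ⟨q, hq, rfl⟩ := hG
  refine ⟨p ⊖ (p ⊖ q), tsub_mem hS hp (tsub_mem hS hp hq), funext fun x => Subtype.ext ?_⟩
  have h1 := (p.1 x).2.1
  have h2 := (q.1 x).2.1
  rw [coe_tsub_apply, coe_tsub_apply, Pi.inf_apply]
  rcases le_total (p.1 x) (q.1 x) with h | h
  · have h' : (p.1 x : ℝ) ≤ q.1 x := h
    rw [inf_eq_left.2 h, max_eq_right (by linarith : (p.1 x : ℝ) - q.1 x ≤ 0), sub_zero,
      max_eq_left h1]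
  · have h' : (q.1 x : ℝ) ≤ p.1 x := h
    rw [inf_eq_right.2 h, max_eq_left (by linarith : 0 ≤ (p.1 x : ℝ) - q.1 x), sub_sub_cancel,
      max_eq_left h2]

theorem exists_mem_coe_eq_min_sum (hS : IsSubalgebra S) {κ : Type*} (s : Finset κ) (p : κ → PL n)
    (hp : ∀ k ∈ s, p k ∈ S) :
    ∃ r ∈ S, ∀ x, (r.1 x : ℝ) = min (∑ k ∈ s, ((p k).1 x : ℝ)) 1 := by
  classical
  induction s using Finset.induction_on with
  | empty => exact ⟨0, hS.zero_mem, fun x => by rw [Finset.sum_empty, min_eq_left zero_le_one]; rfl⟩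
  | insert k s hk ih =>
    obtain ⟨r, hr, hrx⟩ := ih fun l hl => hp l (Finset.mem_insert_of_mem hl)
    refine ⟨p k + r, hS.add_mem _ (hp k (Finset.mem_insert_self k s)) _ hr, fun x => ?_⟩
    have h0 := ((p k).1 x).2.1
    rw [coe_add_apply, hrx, Finset.sum_insert hk, ← min_add_add_left, min_assoc,
      min_eq_right (by linarith : (1 : ℝ) ≤ (p k).1 x + 1)]

theorem exists_mem_coe_eq_combination (hS : IsSubalgebra S) (hproj : ∀ i, proj i ∈ S)
    {w : Fin n → ℝ} {c : ℝ} (hw : ∀ i, 0 ≤ w i) (hc : 0 ≤ c) (hsum : ∑ i, w i + c ≤ 1) :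
    ∃ r ∈ S, ∀ x, (r.1 x : ℝ) = ∑ i, w i * x i + c := by
  have hw1 : ∑ i, w i ≤ 1 := by linarith
  have hwsum : 0 ≤ ∑ i, w i := Finset.sum_nonneg fun i _ => hw i
  obtain ⟨r, hr, hrx⟩ := exists_mem_coe_eq_min_sum hS Finset.univ
    (fun i => clip (w i) • proj i) fun i _ => hS.smul_mem _ _ (hproj i)
  have hval : ∀ (i : Fin n) (x : Fin n → unitInterval),
      ((clip (w i) • proj i : PL n).1 x : ℝ) = w i * x i := fun i x => by
    change (clip (w i) : ℝ) * x i = _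
    rw [coe_clip (hw i) (le_one_of_sum_le_one (c := w) hw hw1 i)]
  refine ⟨r + clip c • MVAlgebra.neg 0, hS.add_mem _ hr _
    (hS.smul_mem _ _ (hS.neg_mem _ hS.zero_mem)), fun x => ?_⟩
  have hle : ∑ i, w i * (x i : ℝ) ≤ ∑ i, w i :=
    Finset.sum_le_sum fun i _ => mul_le_of_le_one_right (hw i) (x i).2.2
  have hone : ((clip c • MVAlgebra.neg 0 : PL n).1 x : ℝ) = c := by
    change (clip c : ℝ) * (1 - 0) = c
    rw [coe_clip hc (by linarith), sub_zero, mul_one]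
  rw [coe_add_apply, hrx, hone]
  simp only [hval]
  rw [min_eq_left (by linarith : ∑ i, w i * (x i : ℝ) ≤ 1), min_eq_left (by linarith)]

/-- Split the coefficients of `q` into positive and negative parts and divide by a large integer
`M`, so that both parts become untruncated combinations `p` and `r`. Then `p ⊖ r` is `max (q / M)
0`, and its `M`-fold truncated sum is `q` clipped to `[0,1]`. -/
theorem clip_affine_mem_functions (hS : IsSubalgebra S) (hproj : ∀ i, proj i ∈ S)
    (q : (Fin n → ℝ) →ᵃ[ℝ] ℝ) :
    (fun x : Fin n → unitInterval => clip (q (fun i => (x i : ℝ)))) ∈ functions S := by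
  set w : Fin n → ℝ := fun i => q.linear (Pi.single i 1) with hw
  set c : ℝ := q 0 with hc
  have hq : ∀ x : Fin n → ℝ, q x = ∑ i, w i * x i + c := fun x => by
    have := congrFun q.decomp x
    rw [this, Pi.add_apply, LinearMap.pi_apply_eq_sum_univ q.linear x]
    refine congrArg (· + c) (Finset.sum_congr rfl fun i _ => ?_)
    rw [smul_eq_mul, mul_comm, hw]
    congr 2
    funext j
    simp only [Pi.single_apply, eq_comm]
  obtain ⟨M, hM⟩ := exists_nat_ge (∑ i, |w i| + |c| + 1)
  have habs : 0 ≤ ∑ i, |w i| := Finset.sum_nonneg fun i _ => abs_nonneg _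
  have hM0 : (0 : ℝ) < M := by linarith [abs_nonneg c]
  have part : ∀ (w' : Fin n → ℝ) (c' : ℝ), (∀ i, 0 ≤ w' i) → 0 ≤ c' → (∀ i, w' i ≤ |w i|) →
      c' ≤ |c| → ∃ r ∈ S, ∀ x, (r.1 x : ℝ) = (∑ i, w' i * x i + c') / M := by
    intro w' c' hw0 hc0 hw' hc'
    obtain ⟨r, hr, hrx⟩ := exists_mem_coe_eq_combination hS hproj (w := fun i => w' i / M)
      (c := c' / M) (fun i => div_nonneg (hw0 i) hM0.le) (div_nonneg hc0 hM0.le) (by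
        rw [← Finset.sum_div, ← add_div, div_le_one hM0]
        have := Finset.sum_le_sum fun i (_ : i ∈ Finset.univ) => hw' i
        linarith)
    refine ⟨r, hr, fun x => ?_⟩
    rw [hrx, add_div, Finset.sum_div]
    simp only [div_mul_eq_mul_div]
  obtain ⟨p, hp, hpx⟩ := part (fun i => max (w i) 0) (max c 0) (fun i => le_max_right _ _)
    (le_max_right _ _) (fun i => max_le (le_abs_self _) (abs_nonneg _))
    (max_le (le_abs_self _) (abs_nonneg _))
  obtain ⟨r, hr, hrx⟩ := part (fun i => max (-w i) 0) (max (-c) 0) (fun i => le_max_right _ _)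
    (le_max_right _ _) (fun i => max_le (neg_le_abs _) (abs_nonneg _))
    (max_le (neg_le_abs _) (abs_nonneg _))
  have hpart : ∀ a : ℝ, max a 0 - max (-a) 0 = a := fun a => by
    rcases le_total a 0 with h | h
    · rw [max_eq_right h, max_eq_left (by linarith)]; ring
    · rw [max_eq_left h, max_eq_right (by linarith)]; ring
  obtain ⟨t, ht, htx⟩ := exists_mem_coe_eq_min_sum hS (Finset.range M) (fun _ => p ⊖ r)
    fun _ _ => tsub_mem hS hp hr
  refine ⟨t, ht, funext fun x => Subtype.ext ?_⟩
  have hdiff : (p.1 x : ℝ) - r.1 x = q (fun i => (x i : ℝ)) / M := by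
    rw [hpx, hrx, ← sub_div, hq, add_sub_add_comm, ← Finset.sum_sub_distrib, hpart]
    simp only [← sub_mul, hpart]
  rw [htx, Finset.sum_const, Finset.card_range, nsmul_eq_mul, coe_tsub_apply, hdiff,
    mul_max_of_nonneg _ _ hM0.le, mul_zero, mul_div_cancel₀ _ hM0.ne', clip, Set.coe_projIcc]
  rcases le_total (q (fun i => (x i : ℝ))) 0 with h | h
  · rw [max_eq_right h, min_eq_left zero_le_one, max_eq_left]
    exact min_le_of_right_le h
  · rw [max_eq_left h, min_comm, max_eq_right]
    exact le_min zero_le_one h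

/-- The coordinate projections generate `PL n`. -/
theorem eq_univ_of_proj_mem (hS : IsSubalgebra S) (hproj : ∀ i, proj i ∈ S) : S = Set.univ := by
  refine Set.eq_univ_of_forall fun f => ?_
  obtain ⟨Q, hQfin, hQ⟩ := f.2.2
  obtain ⟨𝒜, h𝒜⟩ := exists_eq_sup_inf f.2.1 hQfin.toFinset (by simpa using hQ)
  have hmem : f.1 ∈ functions S := by
    rw [h𝒜]
    -- Empty suprema and infima are the constants `0` and `1`, which also belong to the subalgebra.
    refine Finset.sup_induction ⟨0, hS.zero_mem, rfl⟩ (fun F hF G hG => sup_mem_functions hS hF hG)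
      fun A _ => ?_
    refine Finset.inf_induction ⟨MVAlgebra.neg 0, hS.neg_mem _ hS.zero_mem, ?_⟩
      (fun F hF G hG => inf_mem_functions hS hF hG) fun q _ => clip_affine_mem_functions hS hproj q
    funext x
    exact Subtype.ext (sub_zero 1)
  obtain ⟨p, hp, hpf⟩ := hmem
  rwa [← Subtype.ext hpf]

end Generation

end PL

/-! ### The universal property -/

namespace PL

open RieszMVAlgebra

variable {n : ℕ}

theorem proj_injective : Function.Injective (proj : Fin n → PL n) := by
  classical
  intro i j h
  by_contra hne
  have h1 := congrFun (congrArg Subtype.val h) (Pi.single i 1)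
  change (Pi.single i 1 : Fin n → unitInterval) i = (Pi.single i 1 : Fin n → unitInterval) j at h1
  rw [Pi.single_eq_same, Pi.single_eq_of_ne (Ne.symm hne)] at h1
  exact one_ne_zero h1

/-- Each piecewise linear function is the value of a term at the projections. -/
theorem exists_eval_proj_eq (f : PL n) : ∃ t : RieszTerm (Fin n), RieszTerm.eval proj t = f := by
  have h := eq_univ_of_proj_mem (RieszTerm.isSubalgebra_range_eval (proj : Fin n → PL n))
    fun i => ⟨RieszTerm.var i, rfl⟩
  exact (Set.ext_iff.1 h f).2 trivial

/-- Evaluation at a point of the cube. -/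
def evalHom (x : Fin n → unitInterval) : RieszMVHom (PL n) unitInterval :=
  ⟨fun f => f.1 x, rfl, fun _ _ => rfl, fun _ => rfl, fun _ _ => rfl⟩

/-- Evaluating at the points of the cube turns an equality in `PL n` into an equation valid in
`[0,1]`, hence in `R`. -/
theorem eval_eq_of_eval_proj_eq {R : Type v} [RieszMVAlgebra R] (a : Fin n → R)
    {s t : RieszTerm (Fin n)} (h : RieszTerm.eval (proj : Fin n → PL n) s = RieszTerm.eval proj t) :
    RieszTerm.eval a s = RieszTerm.eval a t := by
  refine RieszTerm.eval_eq_eval (fun x => ?_) a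
  have := congrArg (evalHom x).toFun h
  rwa [RieszTerm.map_eval, RieszTerm.map_eval] at this

theorem exists_hom {R : Type v} [RieszMVAlgebra R] (a : Fin n → R) :
    ∃ φ : RieszMVHom (PL n) R, ∀ t, φ.toFun (RieszTerm.eval proj t) = RieszTerm.eval a t := by
  -- The choice of representing terms is harmless: `key` shows that the value at `a` does not depend
  -- on it, which also yields preservation of the operations.
  choose T hT using exists_eval_proj_eq (n := n)
  have key : ∀ (f : PL n) (t : RieszTerm (Fin n)), RieszTerm.eval proj t = f →
      RieszTerm.eval a (T f) = RieszTerm.eval a t := fun f t h =>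
    eval_eq_of_eval_proj_eq a ((hT f).trans h.symm)
  refine ⟨⟨fun f => RieszTerm.eval a (T f), key _ .zero rfl, fun f g => key _ (.add (T f) (T g)) ?_,
    fun f => key _ (.neg (T f)) ?_, fun r f => key _ (.smul r (T f)) ?_⟩, fun t => key _ t rfl⟩
  · rw [RieszTerm.eval, hT, hT]
  · rw [RieszTerm.eval, hT]
  · rw [RieszTerm.eval, hT]

theorem hom_ext {R : Type v} [RieszMVAlgebra R] {φ ψ : RieszMVHom (PL n) R}
    (h : ∀ i, φ.toFun (proj i) = ψ.toFun (proj i)) : φ = ψ := by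
  have hfun : φ.toFun = ψ.toFun := funext fun f => by
    obtain ⟨t, rfl⟩ := exists_eval_proj_eq f
    rw [RieszTerm.map_eval, RieszTerm.map_eval, funext h]
  cases φ
  cases ψ
  cases hfun
  rfl

end PL

theorem corollary7p7 (n : ℕ) :
    RieszMVAlgebra.IsFreelyGeneratedBy.{0, v, 0} (PL.proj : Fin n → PL n) where
  injective := PL.proj_injective
  generates _ hS hproj := PL.eq_univ_of_proj_mem hS hproj
  existsUnique_hom R _ a := by
    obtain ⟨φ, hφ⟩ := PL.exists_hom a
    exact ⟨φ, fun i => hφ (.var i), fun ψ hψ => PL.hom_ext fun i => by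
      rw [hψ i]; exact (hφ (.var i)).symm⟩
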